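/- Let $n\ge 3$ and let $P=\sum_{i=0}^n a_ix^i\in\mathbb Z[a_0,\dots,a_n][x]$ be the generic polynomial of degree $n$ with formal coefficients; put $\boldsymbol F=(P,P',\dots,P^{(n)})$, $F_i=P^{(i)}$, $d_i=\deg_x F_i=n-i$. *Subresultants.* For a $p\times q$ matrix $M$ with $p\le q$ and columns $M_1,\dots,M_q$ let $\operatorname{dp}M=\sum_{i=0}^{q-p}\det[M_1,\dots,M_{p-1},M_{q-i}]\,x^i$. For $\delta=(\delta_1,\dots,\delta_t)$, $\delta_i\ge 0$, $1\le t\le n$, not all $\delta_i$ zero, $\sum_i\delta_i\le n$, let $m=\max\{d_i+\delta_i: 1\le i\le t,\ \delta_i\ne0\}$ and let $\delta_0=m-n$ if $m\ge n$, $\delta_0=1$ otherwise. Let $R_\delta=\operatorname{dp}M_\delta$, where $M_\delta$ is the matrix with $\delta_0+n$ columns whose rows are the coefficient vectors (with respect to $x^{\delta_0+n-1},\dots,x^0$) of $x^{\delta_0-1}F_0,\dots,F_0,\ x^{\delta_1-1}F_1,\dots,F_1,\ \dots,\ x^{\delta_t-1}F_t,\dots,F_t$. If $\sum_i\delta_i=n$,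 then $R_\delta\in\mathbb Z[a_0,\dots,a_n]$. *Discriminant sequence.* For a polynomial $Q$ of degree $d\geq 1$ in $x$, $D_j(Q)$ ($1\le j\le d$) is the leading principal $2j\times 2j$ minor of the $2d\times 2d$ matrix whose rows $2k+1$ and $2k+2$ ($0\le k<d$) contain, from column $k+1$ on, the coefficients of $x^d,\dots,x^0$ in $Q$ and in $Q'$, respectively (the first of the latter being $0$), and zeros elsewhere. *Conditions.* Let $\mathcal M(n)$ be the set of $\mu=(\mu_1,\dots,\mu_m)$ with $\mu_1\ge\dots\ge\mu_m\ge1$ and $\sum_j\mu_j=n$. For $\mu\in\mathcal M(n)$ let $\bar\mu_i=\#\{j:\mu_j\ge i\}$, $\bar\mu=(\bar\mu_1,\dots,\bar\mu_n)$ (trailing zeros are immaterial when $\bar\mu$ is compared with elements of $\mathcal M(n)$), $G_0=P$ and $G_i=R_{(\bar\mu_1,\dots,\bar\mu_i)}$ for $i\ge1$. For every $\mu\in\mathcal M(n)$ and every way of splitting the entries of $\mu$ into two weakly decreasing vectors $(\mu_R;\mu_I)$ with $\mu_{I,1}=\mu_{I,2}\ge\mu_{I,3}=\mu_{I,4}\ge\cdots$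 ($\mu_I$ of even length), the algorithm ParametricCompleteMultiplicity outputs, as the condition for $P$ to have real roots of multiplicities $\mu_R$ and imaginary roots of multiplicities $\mu_I$, the conjunction of - $R_\gamma=0$ for all $\gamma\in\mathcal M(n)$ that are lexicographically larger than $\bar\mu$, - $R_{\bar\mu}\ne0$, - $\operatorname{Var}\bigl(D_1(G_i),\dots,D_{\bar\mu_{i+1}}(G_i)\bigr)=\bar\mu_{I,i+1}/2$ for $i=0,\dots,\mu_1-1$, where $\operatorname{Var}$ is the number of sign changes of the revised sign list and $\bar\mu_{I,i}=\#\{j:\mu_{I,j}\ge i\}$. Let $d_{\mathrm{QXY}}$ be the maximum of the total degrees in $a_0,\dots,a_n$ of the polynomials that appear in these conditions (the $R_\gamma$, $R_{\bar\mu}$ and $D_j(G_i)$ above, over all $\mu$ and all splittings). Then $d_{\mathrm{QXY}}=n(n-1)$. -/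

import Mathlib

open Polynomial

noncomputable section

namespace QXY

/-! ### Determinant polynomials and generalized subresultants -/

/-- The determinant polynomial of a `p × q` matrix, `p ≤ q`: the sum over `0 ≤ i ≤ q - p` of
`det [M₁, …, M_{p-1}, M_{q-i}] xⁱ`, where `M_k` is the `k`-th column (counted from `1`). -/
def detPoly {R : Type*} [CommRing R] {p q : ℕ} (h : p ≤ q) (M : Matrix (Fin p) (Fin q) R) :
    R[X] :=
  ∑ i ∈ Finset.range (q - p + 1),
    C (Matrix.det (M.submatrix id
      (fun c : Fin p => (⟨if c.val + 1 < p then c.val else q - 1 - i, by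
        have := c.isLt; split_ifs <;> omega⟩ : Fin q)))) * X ^ i

/-- `max {dᵢ + δᵢ : 1 ≤ i ≤ t, δᵢ ≠ 0}` with `dᵢ = deg Fᵢ`; here `δ = [δ₁, …, δ_t]`. -/
def maxShift {R : Type*} [CommRing R] (F : ℕ → R[X]) (δ : List ℕ) : ℕ :=
  ((Finset.range δ.length).filter (fun k => δ.getD k 0 ≠ 0)).sup
    (fun k => (F (k + 1)).natDegree + δ.getD k 0)

/-- The number `δ₀` of rows of `F₀` in the generalized Sylvester matrix. -/
def deltaZero {R : Type*} [CommRing R] (F : ℕ → R[X]) (δ : List ℕ) : ℕ :=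
  if (F 0).natDegree ≤ maxShift F δ then maxShift F δ - (F 0).natDegree else 1

/-- The polynomials whose coefficients are the rows of the generalized Sylvester matrix:
`x^{δ₀-1} F₀, …, F₀, x^{δ₁-1} F₁, …, F₁, …, x^{δ_t-1} F_t, …, F_t`. -/
def sylvesterRows {R : Type*} [CommRing R] (F : ℕ → R[X]) (δ : List ℕ) : List R[X] :=
  (deltaZero F δ :: δ).zipIdx.flatMap
    (fun di => (List.range di.1).reverse.map (fun k => X ^ k * F di.2))

/-- The `δ`-th generalized Sylvester matrix of `F`; it has `δ₀ + d₀` columns, holding the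
coefficients of `x^{δ₀+d₀-1}, …, x⁰`. -/
def sylvesterMatrix {R : Type*} [CommRing R] (F : ℕ → R[X]) (δ : List ℕ) :
    Matrix (Fin (sylvesterRows F δ).length) (Fin (deltaZero F δ + (F 0).natDegree)) R :=
  Matrix.of fun r c =>
    ((sylvesterRows F δ).get r).coeff (deltaZero F δ + (F 0).natDegree - 1 - c.val)

/-- The `δ`-th subresultant `R_δ(F)`. The matrix is wide or square as soon as
`δ₁ + ⋯ + δ_t ≤ d₀`, the only case in which the subresultant is defined mathematically. -/
def subres {R : Type*} [CommRing R] (F : ℕ → R[X]) (δ : List ℕ) : R[X] :=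
  if h : (sylvesterRows F δ).length ≤ deltaZero F δ + (F 0).natDegree then
    detPoly h (sylvesterMatrix F δ)
  else 0

/-! ### Discriminant sequence -/

/-- The upper left `N × N` block of the discrimination matrix of `Q`. For `d = deg Q` and
`N = 2 d` it is the whole matrix. Rows `2k` and `2k+1` (counted from `0`) hold the coefficients of
`x^d, …, x⁰` in `Q` and in `Q'` respectively, starting at column `k`. -/
def discrBlock {R : Type*} [CommRing R] (Q : R[X]) (N : ℕ) : Matrix (Fin N) (Fin N) R :=
  Matrix.of fun r s =>
    if r.val / 2 ≤ s.val ∧ s.val ≤ r.val / 2 + Q.natDegree then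
      (if r.val % 2 = 0 then Q else derivative Q).coeff (Q.natDegree + r.val / 2 - s.val)
    else 0

/-- The `j`-th member `D_j` (`1 ≤ j ≤ deg Q`) of the discriminant sequence of `Q`:
the `2j × 2j` leading principal minor of the discrimination matrix. -/
def discrSeq {R : Type*} [CommRing R] (Q : R[X]) (j : ℕ) : R :=
  (discrBlock Q (2 * j)).det

/-! ### Multiplicity vectors -/

/-- `μ ∈ M(n)`: `μ₁ ≥ ⋯ ≥ μ_m ≥ 1` with sum `n`. -/
def IsMult (n : ℕ) (μ : List ℕ) : Prop :=
  μ.Pairwise (· ≥ ·) ∧ (∀ a ∈ μ, 1 ≤ a) ∧ μ.sum = n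

/-- `(μR; μI)` is a complete multiplicity for degree `n`: both parts are weakly decreasing and
positive, the entries of `μI` come in equal consecutive pairs, and the total sum is `n`. -/
def IsCompleteMult (n : ℕ) (μR μI : List ℕ) : Prop :=
  μR.Pairwise (· ≥ ·) ∧ (∀ a ∈ μR, 1 ≤ a) ∧
  μI.Pairwise (· ≥ ·) ∧ (∀ a ∈ μI, 1 ≤ a) ∧
  Even μI.length ∧ (∀ k, μI.getD (2 * k) 0 = μI.getD (2 * k + 1) 0) ∧
  μR.sum + μI.sum = n

/-- The `i`-th entry (`i ≥ 1`) of the conjugate of `μ`: the number of `j` with `μ_j ≥ i`. -/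
def conjPart (μ : List ℕ) (i : ℕ) : ℕ := μ.countP (fun a => i ≤ a)

/-- The conjugate `(μ̄₁, …, μ̄_n)` of `μ ∈ M(n)`. -/
def conj (n : ℕ) (μ : List ℕ) : List ℕ := (List.range n).map (fun i => conjPart μ (i + 1))

/-! ### The generic polynomial and the conditions produced by the algorithm -/

/-- The parameter ring `ℤ[a₀, …, a_n]`. -/
abbrev Param (n : ℕ) : Type := MvPolynomial (Fin (n + 1)) ℤ

/-- The generic polynomial `P = a_n xⁿ + ⋯ + a₀` with formal coefficients. -/
def genericPoly (n : ℕ) : (Param n)[X] :=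
  ∑ i : Fin (n + 1), C (MvPolynomial.X i) * X ^ (i : ℕ)

/-- The sequence `F = (P, P', P'', …)` of derivatives of the generic polynomial. -/
def derivs (n : ℕ) (k : ℕ) : (Param n)[X] := derivative^[k] (genericPoly n)

/-- For `γ` with sum `n` the subresultant `R_γ(F)` is free of `x`;
this is that element of `ℤ[a₀, …, a_n]`. -/
def multDiscr (n : ℕ) (γ : List ℕ) : Param n := (subres (derivs n) γ).coeff 0

/-- `G₀ = P` and `G_i = R_{(μ̄₁, …, μ̄_i)}(F)` for `i > 0`. -/
def incGcd (n : ℕ) (μ : List ℕ) (i : ℕ) : (Param n)[X] :=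
  if i = 0 then genericPoly n else subres (derivs n) ((conj n μ).take i)

/-- The atomic conditions on the parameters: `p = 0`, `p ≠ 0`, and `Var(L) = ν`, which says that
the revised sign list of the values of the polynomials in `L` has `ν` sign changes. -/
inductive Atom (n : ℕ) : Type
  | eqZero (p : Param n) : Atom n
  | neZero (p : Param n) : Atom n
  | varEq (L : List (Param n)) (ν : ℕ) : Atom n

/-- The polynomials that appear in an atomic condition. -/
def Atom.polys {n : ℕ} : Atom n → Set (Param n)
  | .eqZero p => {p}
  | .neZero p => {p}
  | .varEq L _ => {p | p ∈ L}

/-- The condition (the conjunction of a set of atoms) that the algorithm attaches to a `2`-partition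
`(μR; μI)` of `μ ∈ M(n)`: `R_γ(F) = 0` for all `γ ∈ M(n)` lexicographically larger than `μ̄`;
`R_{μ̄}(F) ≠ 0`; and `Var(D₁(G_i), …, D_{μ̄_{i+1}}(G_i)) = μ̄_{I,i+1} / 2` for `0 ≤ i ≤ μ₁ - 1`. -/
def condition (n : ℕ) (μ μI : List ℕ) : Set (Atom n) :=
  {A | ∃ γ, IsMult n γ ∧ List.Lex (· < ·) (conj n μ) γ ∧ A = .eqZero (multDiscr n γ)} ∪
  {.neZero (multDiscr n (conj n μ))} ∪
  {A | ∃ i < μ.headD 0,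
    A = .varEq ((List.range (conjPart μ (i + 1))).map (fun j => discrSeq (incGcd n μ i) (j + 1)))
      (conjPart μI (i + 1) / 2)}

/-- The output of the algorithm: all pairs `((μR; μI), C)` where `(μR; μI)` is a `2`-partition of
some `μ ∈ M(n)` and `C` is the condition attached to it. -/
def output (n : ℕ) : Set ((List ℕ × List ℕ) × Set (Atom n)) :=
  {o | ∃ μ μR μI, IsMult n μ ∧ IsCompleteMult n μR μI ∧ (μR ++ μI).Perm μ ∧
    o = ((μR, μI), condition n μ μI)}

/-- The polynomials in `a₀, …, a_n` that appear in the conditions produced by the algorithm. -/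
def conditionPolys (n : ℕ) : Set (Param n) :=
  {p | ∃ o ∈ output n, ∃ A ∈ o.2, p ∈ A.polys}

end QXY

end

/-!
The entries of the generalized Sylvester matrices of `P` are linear in the `aᵢ`, so for a weakly
decreasing `δ` the coefficients of `R_δ` are forms of degree `δ₁ - 1 + ∑ δᵢ`, and `D_j(G_i)` is a
form of degree `2j · (μ̄₁ - 1 + μ̄₁ + ⋯ + μ̄_i)`. Since `j ≤ μ̄_{i+1} ≤ μ̄₁` and `∑ μ̄ᵢ = n`, the
two factors have sum less than `2n`, whence their product is at most `n(n - 1)`. The `R_γ` and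
the `D_j(P)` have degree at most `2n ≤ n(n - 1)`.

Equality holds for `D_s(R_(t))` with `s = ⌊n/2⌋` and `t = n - s`, which belongs to
`μ = (2, …, 2, 1, …, 1)`, once this form of degree `2s(2t - 1) = n(n - 1)` is known to be nonzero.
Specialize `P` to `f = g²h` over `ℚ`, where `gh` is separable of degree `t` and `g` has degree `s`.
Then `R_(t)` becomes the first subresultant of `f` and `f'` that does not vanish, that is, a
nonzero multiple of `gcd(f, f') = g`, and `D_s(g) ≠ 0` because `g` is separable.
-/

namespace QXY

section Determinants

variable {R : Type*} [CommRing R] {p q : ℕ}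

/-- The matrix whose rows hold the coefficients of `x^{q-1}, …, x⁰` in the polynomials of a
family `L`. Sylvester-type matrices, such as `sylvesterMatrix` and `discrBlock`, are of this
form. -/
def coeffMatrix {ι : Type*} (q : ℕ) (L : ι → R[X]) : Matrix ι (Fin q) R :=
  Matrix.of fun r c => (L r).coeff (q - 1 - c.val)

/-- The columns `1, …, p - 1, q - i` that make up the coefficient of `xⁱ` in `detPoly`,
counted from `0`. -/
def detPolyColumn (h : p ≤ q) (i : ℕ) (c : Fin p) : Fin q :=
  ⟨if c.val + 1 < p then c.val else q - 1 - i, by have := c.isLt; split_ifs <;> omega⟩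

theorem coeff_detPoly (h : p ≤ q) (M : Matrix (Fin p) (Fin q) R) (i : ℕ) :
    (detPoly h M).coeff i =
      if i < q - p + 1 then (M.submatrix id (detPolyColumn h i)).det else 0 := by
  have hsum : detPoly h M = ∑ i ∈ Finset.range (q - p + 1),
      C (M.submatrix id (detPolyColumn h i)).det * X ^ i := rfl
  simp [hsum, coeff_X_pow]

theorem natDegree_detPoly_le (h : p ≤ q) (M : Matrix (Fin p) (Fin q) R) :
    (detPoly h M).natDegree ≤ q - p := by
  refine natDegree_le_iff_coeff_eq_zero.2 fun i hi => ?_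
  rw [coeff_detPoly, if_neg (by omega)]

theorem map_detPoly {S : Type*} [CommRing S] (φ : R →+* S) (h : p ≤ q)
    (M : Matrix (Fin p) (Fin q) R) : (detPoly h M).map φ = detPoly h (M.map φ) := by
  ext i
  rw [coeff_map, coeff_detPoly, coeff_detPoly, apply_ite φ, map_zero, RingHom.map_det]
  rfl

theorem coeffMatrix_submatrix_updateCol_last (h : p + 1 ≤ q) (L : Fin (p + 1) → R[X]) {i : ℕ}
    (hi : i < q) :
    ((coeffMatrix q L).submatrix id (detPolyColumn h 0)).updateCol (Fin.last p)
        (fun r => (L r).coeff i) =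
      (coeffMatrix q L).submatrix id (detPolyColumn h i) := by
  ext r c
  induction c using Fin.lastCases with
  | last =>
    simp [coeffMatrix, detPolyColumn, show q - 1 - (q - 1 - i) = i by omega]
  | cast c => simp [Matrix.updateCol_ne, coeffMatrix, detPolyColumn, Fin.castSucc_ne_last]

theorem det_coeffMatrix_submatrix_eq_zero (h : p ≤ q) (L : Fin p → R[X]) {i : ℕ}
    (hpi : q - p < i) (hi : i < q) :
    ((coeffMatrix q L).submatrix id (detPolyColumn h i)).det = 0 := by
  have hne : (⟨q - 1 - i, by omega⟩ : Fin p) ≠ ⟨p - 1, by omega⟩ := by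
    simp only [ne_eq, Fin.mk.injEq]
    omega
  refine Matrix.det_zero_of_column_eq hne fun r => ?_
  have hlt : q - 1 - i + 1 < p := by omega
  have hlast : ¬ p - 1 + 1 < p := by omega
  simp only [Matrix.submatrix_apply, detPolyColumn, if_pos hlt, if_neg hlast]

theorem coeff_detPoly_coeffMatrix (h : p + 1 ≤ q) (L : Fin (p + 1) → R[X])
    (hL : ∀ r, (L r).natDegree < q) (i : ℕ) :
    (detPoly h (coeffMatrix q L)).coeff i =
      ((coeffMatrix q L).submatrix id (detPolyColumn h 0)).cramer (fun r => (L r).coeff i)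
        (Fin.last p) := by
  rw [Matrix.cramer_apply, coeff_detPoly]
  by_cases hiq : i < q
  · rw [coeffMatrix_submatrix_updateCol_last h L hiq]
    split_ifs with hi
    · rfl
    · exact (det_coeffMatrix_submatrix_eq_zero h L (by omega) hiq).symm
  · rw [if_neg (by omega)]
    refine (Matrix.det_eq_zero_of_column_eq_zero (Fin.last p) fun r => ?_).symm
    rw [Matrix.updateCol_self]
    exact coeff_eq_zero_of_natDegree_lt ((hL r).trans_le (not_lt.1 hiq))

theorem detPoly_coeffMatrix_eq_sum (h : p + 1 ≤ q) (L : Fin (p + 1) → R[X])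
    (hL : ∀ r, (L r).natDegree < q) :
    detPoly h (coeffMatrix q L) =
      ∑ r, C (((coeffMatrix q L).submatrix id (detPolyColumn h 0)).adjugate (Fin.last p) r) *
        L r := by
  ext i
  simp only [coeff_detPoly_coeffMatrix h L hL, Matrix.cramer_eq_adjugate_mulVec,
    finsetSum_coeff, coeff_C_mul]
  rfl

theorem dvd_detPoly_coeffMatrix (hp : 0 < p) (h : p ≤ q) {L : Fin p → R[X]}
    (hL : ∀ r, (L r).natDegree < q) {g : R[X]} (hg : ∀ r, g ∣ L r) :
    g ∣ detPoly h (coeffMatrix q L) := by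
  obtain ⟨p, rfl⟩ := Nat.exists_eq_add_one.2 hp
  rw [detPoly_coeffMatrix_eq_sum h L hL]
  exact Finset.dvd_sum fun r _ => (hg r).mul_left _

theorem coeff_detPoly_coeffMatrix_sub (h : p ≤ q) (L : Fin p → R[X]) :
    (detPoly h (coeffMatrix q L)).coeff (q - p) =
      ((coeffMatrix q L).submatrix id (Fin.castLE h)).det := by
  rw [coeff_detPoly, if_pos (Nat.lt_succ_self _)]
  congr 2
  ext c
  have := c.isLt
  simp only [detPolyColumn, Fin.val_castLE]
  split_ifs <;> omega

end Determinants

section Field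

variable {K : Type*} [Field K] {p q : ℕ}

/- A vanishing minor gives a nontrivial combination of the rows of degree less than `q - p`; as
`g` divides it, it is zero. -/
theorem det_coeffMatrix_ne_zero (h : p ≤ q) {L : Fin p → K[X]} (hL : ∀ r, (L r).natDegree < q)
    {g : K[X]} (hg : ∀ r, g ∣ L r) (hgq : q - p ≤ g.natDegree) (hind : LinearIndependent K L) :
    ((coeffMatrix q L).submatrix id (Fin.castLE h)).det ≠ 0 := by
  intro hdet
  obtain ⟨v, hv, hvM⟩ := Matrix.exists_vecMul_eq_zero_iff.2 hdet
  refine hv (funext (Fintype.linearIndependent_iff.1 hind v ?_))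
  have hcoeff : ∀ i, g.natDegree ≤ i → (∑ r, v r • L r).coeff i = 0 := by
    intro i hi
    simp only [finsetSum_coeff, coeff_smul]
    by_cases hiq : i < q
    · have hcol := congrFun hvM ⟨q - 1 - i, by omega⟩
      simpa [Matrix.vecMul, dotProduct, coeffMatrix, show q - 1 - (q - 1 - i) = i by omega]
        using hcol
    · refine Finset.sum_eq_zero fun r _ => ?_
      rw [coeff_eq_zero_of_natDegree_lt ((hL r).trans_le (not_lt.1 hiq)), smul_zero]
  have hdvd : g ∣ ∑ r, v r • L r := Finset.dvd_sum fun r _ => dvd_smul_of_dvd _ (hg r)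
  by_contra hne
  exact hne (leadingCoeff_eq_zero.1 (hcoeff _ (natDegree_le_of_dvd hdvd hne)))

theorem associated_detPoly_coeffMatrix (hp : 0 < p) (h : p ≤ q) {L : Fin p → K[X]}
    (hL : ∀ r, (L r).natDegree < q) {g : K[X]} (hg : ∀ r, g ∣ L r) (hgq : g.natDegree = q - p)
    (hind : LinearIndependent K L) : Associated (detPoly h (coeffMatrix q L)) g := by
  have hcoeff := det_coeffMatrix_ne_zero h hL hg hgq.ge hind
  rw [← coeff_detPoly_coeffMatrix_sub] at hcoeff
  refine (associated_of_dvd_of_natDegree_le (dvd_detPoly_coeffMatrix hp h hL hg) ?_ ?_).symm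
  · exact fun h0 => hcoeff (by rw [h0, coeff_zero])
  · exact (natDegree_detPoly_le _ _).trans hgq.ge

theorem linearIndependent_X_pow_mul {U : K[X]} (hU : U ≠ 0) :
    LinearIndependent K fun i : ℕ => X ^ i * U := by
  have hX : LinearIndependent K fun i : ℕ => (X : K[X]) ^ i := by
    simpa only [coe_basisMonomials, monomial_one_right_eq_X_pow]
      using (basisMonomials K).linearIndependent
  exact hX.map' (LinearMap.mulRight K U)
    (LinearMap.ker_eq_bot.2 fun _ _ h => mul_right_cancel₀ hU h)

theorem linearIndependent_shifts {U V : K[X]} (hU : U ≠ 0) (hUV : IsCoprime U V) :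
    LinearIndependent K
      (Sum.elim (fun i : ℕ => X ^ i * U) fun j : Fin U.natDegree => X ^ j.val * V) := by
  refine (linearIndependent_X_pow_mul hU).sum_type ?_ ?_
  · rcases eq_or_ne V 0 with rfl | hV
    · have hdeg : U.natDegree = 0 := natDegree_eq_zero_of_isUnit (isCoprime_zero_right.1 hUV)
      have : IsEmpty (Fin U.natDegree) := by rw [hdeg]; infer_instance
      exact linearIndependent_empty_type
    · exact (linearIndependent_X_pow_mul hV).comp _ Fin.val_injective
  · rw [Submodule.disjoint_def]
    intro f hfU hfV
    have hdvd : f ∈ (Ideal.span {U}).restrictScalars K := by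
      refine Submodule.span_le.2 ?_ hfU
      rintro _ ⟨i, rfl⟩
      exact Ideal.mem_span_singleton.2 (dvd_mul_left _ _)
    have hmul : f ∈ (degreeLT K U.natDegree).map (LinearMap.mulRight K V) := by
      refine Submodule.span_le.2 ?_ hfV
      rintro _ ⟨j, rfl⟩
      refine ⟨X ^ j.val, mem_degreeLT.2 ?_, rfl⟩
      rw [degree_X_pow]
      exact_mod_cast j.isLt
    obtain ⟨B, hB, rfl⟩ := hmul
    have hUB : U ∣ B := hUV.dvd_of_dvd_mul_right (Ideal.mem_span_singleton.1 hdvd)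
    have hB0 : B = 0 := by
      refine eq_zero_of_dvd_of_degree_lt hUB ?_
      rw [degree_eq_natDegree hU]
      exact mem_degreeLT.1 hB
    simp [hB0]

theorem linearIndependent_get_map {ι V : Type*} [AddCommGroup V] [Module K V] {v : ι → V}
    (hv : LinearIndependent K v) {l : List ι} (hl : l.Nodup) :
    LinearIndependent K (l.map v).get := by
  have hget : (l.map v).get = v ∘ l.get ∘ Fin.cast (List.length_map v) := by
    ext r
    simp
  rw [hget]
  exact hv.comp _ ((List.nodup_iff_injective_get.1 hl).comp (Fin.cast_injective _))

end Field

section RowDetPoly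

variable {R : Type*} [CommRing R]

/-- The determinant polynomial of the list of polynomials `L`, whose coefficients at
`x^{q-1}, …, x⁰` are the rows of a matrix with `q` columns; it is `0` if `L` has more than `q`
members. In contrast to the matrix, it can be rewritten along equalities of `q` and `L`. -/
noncomputable def rowDetPoly (q : ℕ) (L : List R[X]) : R[X] :=
  if h : L.length ≤ q then detPoly h (coeffMatrix q L.get) else 0

theorem natDegree_rowDetPoly_le (q : ℕ) (L : List R[X]) :
    (rowDetPoly q L).natDegree ≤ q - L.length := by
  unfold rowDetPoly
  split_ifs with h
  · exact natDegree_detPoly_le h _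
  · simp

theorem map_rowDetPoly {S : Type*} [CommRing S] (φ : R →+* S) (q : ℕ) (L : List R[X]) :
    (rowDetPoly q L).map φ = rowDetPoly q (L.map (Polynomial.map φ)) := by
  have hcast : ∀ (L' : List S[X]) (hL : L'.length = L.length),
      rowDetPoly q L' = if h : L.length ≤ q then
        detPoly h (coeffMatrix q fun r => L'.get (r.cast hL.symm)) else 0 := by
    intro L' hL
    generalize L.length = p at hL
    subst hL
    rfl
  rw [hcast _ (List.length_map _), rowDetPoly, apply_dite (Polynomial.map φ), Polynomial.map_zero]
  congr! 2 with h
  rw [map_detPoly]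
  congr 1
  ext r c
  simp [coeffMatrix]

theorem associated_rowDetPoly {K : Type*} [Field K] {q : ℕ} {L : List K[X]} (hnil : L ≠ [])
    (hL : ∀ f ∈ L, f.natDegree < q) {g : K[X]} (hg : ∀ f ∈ L, g ∣ f)
    (hgq : g.natDegree + L.length = q) (hind : LinearIndependent K L.get) :
    Associated (rowDetPoly q L) g := by
  have h : L.length ≤ q := hgq ▸ Nat.le_add_left _ _
  rw [rowDetPoly, dif_pos h]
  exact associated_detPoly_coeffMatrix (List.length_pos_iff.2 hnil) h
    (fun r => hL _ (L.get_mem r)) (fun r => hg _ (L.get_mem r)) (by omega) hind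

end RowDetPoly

section Subresultants

variable {R : Type*} [CommRing R] (F : ℕ → R[X]) (δ : List ℕ)

theorem subres_eq_rowDetPoly :
    subres F δ = rowDetPoly (deltaZero F δ + (F 0).natDegree) (sylvesterRows F δ) := rfl

variable {F δ} in
theorem le_maxShift {k : ℕ} (hk : δ.getD k 0 ≠ 0) :
    (F (k + 1)).natDegree + δ.getD k 0 ≤ maxShift F δ := by
  have hlt : k < δ.length := by
    by_contra hge
    exact hk (List.getD_eq_default _ _ (not_lt.1 hge))
  exact Finset.le_sup (f := fun k => (F (k + 1)).natDegree + δ.getD k 0)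
    (Finset.mem_filter.2 ⟨Finset.mem_range.2 hlt, hk⟩)

theorem maxShift_le_deltaZero_add : maxShift F δ ≤ deltaZero F δ + (F 0).natDegree := by
  unfold deltaZero
  split_ifs <;> omega

variable {F δ} in
theorem exists_eq_X_pow_mul_of_mem_sylvesterRows {f : R[X]} (hf : f ∈ sylvesterRows F δ) :
    ∃ i k, k < (deltaZero F δ :: δ).getD i 0 ∧ f = X ^ k * F i := by
  obtain ⟨⟨d, i⟩, hdi, hf⟩ := List.mem_flatMap.1 hf
  obtain ⟨k, hk, rfl⟩ := List.mem_map.1 hf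
  refine ⟨i, k, ?_, rfl⟩
  rw [List.getD_eq_getElem?_getD, List.mem_zipIdx_iff_getElem?.1 hdi]
  exact List.mem_range.1 (List.mem_reverse.1 hk)

variable {F δ} in
theorem natDegree_lt_of_mem_sylvesterRows {f : R[X]} (hf : f ∈ sylvesterRows F δ) :
    f.natDegree < deltaZero F δ + (F 0).natDegree := by
  obtain ⟨i, k, hk, rfl⟩ := exists_eq_X_pow_mul_of_mem_sylvesterRows hf
  have hdeg : (X ^ k * F i).natDegree ≤ k + (F i).natDegree :=
    natDegree_mul_le.trans (Nat.add_le_add_right (natDegree_X_pow_le k) _)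
  refine hdeg.trans_lt ?_
  cases i with
  | zero =>
    rw [List.getD_cons_zero] at hk
    omega
  | succ i =>
    rw [List.getD_cons_succ] at hk
    have hshift := le_maxShift (F := F) (δ := δ) (k := i) (by omega)
    have hmax := maxShift_le_deltaZero_add F δ
    omega

theorem length_sylvesterRows : (sylvesterRows F δ).length = deltaZero F δ + δ.sum := by
  have hlen : (fun di : ℕ × ℕ => ((List.range di.1).reverse.map fun k => X ^ k * F di.2).length) =
      Prod.fst := by
    ext
    simp
  rw [sylvesterRows, List.length_flatMap, hlen, List.zipIdx_map_fst, List.sum_cons]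

theorem sylvesterRows_singleton (F : ℕ → R[X]) (t : ℕ) :
    sylvesterRows F [t] = (List.range (deltaZero F [t])).reverse.map (fun k => X ^ k * F 0) ++
      (List.range t).reverse.map (fun k => X ^ k * F 1) := by
  simp [sylvesterRows]

theorem natDegree_subres_le : (subres F δ).natDegree ≤ (F 0).natDegree - δ.sum := by
  refine (natDegree_rowDetPoly_le _ _).trans ?_
  rw [length_sylvesterRows]
  omega

variable {F δ} in
theorem map_subres {S : Type*} [CommRing S] (φ : R →+* S)
    (hF : ∀ k, ((F k).map φ).natDegree = (F k).natDegree) :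
    (subres F δ).map φ = subres (fun k => (F k).map φ) δ := by
  have hmax : maxShift (fun k => (F k).map φ) δ = maxShift F δ := by simp only [maxShift, hF]
  have hzero : deltaZero (fun k => (F k).map φ) δ = deltaZero F δ := by
    simp only [deltaZero, hmax, hF]
  have hrows : (sylvesterRows F δ).map (Polynomial.map φ) =
      sylvesterRows (fun k => (F k).map φ) δ := by
    simp [sylvesterRows, hzero, List.map_flatMap, Function.comp_def]
  rw [subres_eq_rowDetPoly, map_rowDetPoly, hrows, subres_eq_rowDetPoly, hzero, hF]

theorem deltaZero_mul_singleton {K : Type*} [Field K] {F : ℕ → K[X]} {g u w : K[X]} (hg : g ≠ 0)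
    (hu : 0 < u.natDegree) (hw : w ≠ 0) (h0 : F 0 = g * u) (h1 : F 1 = g * w) :
    deltaZero F [u.natDegree] = w.natDegree := by
  have hmax : maxShift F [u.natDegree] = (F 1).natDegree + u.natDegree := by
    simp [maxShift, Finset.filter_singleton, hu.ne']
  rw [deltaZero, hmax, h0, h1, natDegree_mul hg (ne_zero_of_natDegree_gt hu), natDegree_mul hg hw,
    if_pos (by omega)]
  omega

theorem associated_subres_singleton {K : Type*} [Field K] {F : ℕ → K[X]} {g u w : K[X]}
    (hg : g ≠ 0) (hu : 0 < u.natDegree) (huw : IsCoprime u w) (h0 : F 0 = g * u)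
    (h1 : F 1 = g * w) : Associated (subres F [u.natDegree]) g := by
  have hu0 : u ≠ 0 := ne_zero_of_natDegree_gt hu
  have hw0 : w ≠ 0 := by
    rintro rfl
    exact hu.ne' (natDegree_eq_zero_of_isUnit (isCoprime_zero_right.1 huw))
  let shift : ℕ ⊕ Fin u.natDegree → K[X] :=
    Sum.elim (fun i => X ^ i * u) fun j => X ^ j.val * w
  let index : List (ℕ ⊕ Fin u.natDegree) :=
    (List.range w.natDegree).reverse.map Sum.inl ++
      (List.finRange u.natDegree).reverse.map Sum.inr
  have hzero : deltaZero F [u.natDegree] = w.natDegree := deltaZero_mul_singleton hg hu hw0 h0 h1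
  have hrows : sylvesterRows F [u.natDegree] = index.map fun x => g * shift x := by
    rw [sylvesterRows_singleton, hzero, h0, h1, ← List.map_coe_finRange_eq_range (n := u.natDegree)]
    simp only [index, shift, List.map_append, List.map_reverse, List.map_map, Function.comp_def,
      Sum.elim_inl, Sum.elim_inr, mul_left_comm g]
  have hnodup : index.Nodup := by
    refine List.Nodup.append ?_ ?_ ?_
    · exact (List.nodup_reverse.2 List.nodup_range).map Sum.inl_injective
    · exact (List.nodup_reverse.2 (List.nodup_finRange _)).map Sum.inr_injective
    · simp [List.disjoint_left]
  have hind : LinearIndependent K fun x => g * shift x :=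
    (linearIndependent_shifts hu0 huw).map' (LinearMap.mulLeft K g)
      (LinearMap.ker_eq_bot.2 fun _ _ h => mul_left_cancel₀ hg h)
  refine associated_rowDetPoly ?_ (fun f => natDegree_lt_of_mem_sylvesterRows) ?_ ?_ ?_
  · refine List.ne_nil_of_length_pos ?_
    rw [length_sylvesterRows, List.sum_singleton]
    omega
  · rw [hrows, List.forall_mem_map]
    exact fun x _ => dvd_mul_right _ _
  · rw [length_sylvesterRows, List.sum_singleton, h0, natDegree_mul hg hu0]
    omega
  · rw [hrows]
    exact linearIndependent_get_map hind hnodup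

end Subresultants

section DiscriminantSequence

variable {R : Type*} [CommRing R]

theorem discrBlock_eq_coeffMatrix (Q : R[X]) :
    discrBlock Q (2 * Q.natDegree) = coeffMatrix (2 * Q.natDegree)
      fun r : Fin (2 * Q.natDegree) =>
        X ^ (Q.natDegree - 1 - r.val / 2) * if r.val % 2 = 0 then Q else derivative Q := by
  ext r c
  have hr := r.isLt
  have hc := c.isLt
  have hcoeff : ∀ f : R[X], f.natDegree ≤ Q.natDegree →
      (if r.val / 2 ≤ c.val ∧ c.val ≤ r.val / 2 + Q.natDegree then
        f.coeff (Q.natDegree + r.val / 2 - c.val) else 0) =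
      (X ^ (Q.natDegree - 1 - r.val / 2) * f).coeff (2 * Q.natDegree - 1 - c.val) := by
    intro f hf
    rw [coeff_X_pow_mul']
    split_ifs
    · congr 1
      omega
    · omega
    · exact (coeff_eq_zero_of_natDegree_lt (by omega)).symm
    · rfl
  refine hcoeff _ ?_
  split_ifs
  · exact le_rfl
  · exact (natDegree_derivative_le Q).trans (Nat.sub_le _ _)

theorem discrSeq_natDegree_ne_zero {K : Type*} [Field K] {Q : K[X]} (hQ : Q.Separable) :
    discrSeq Q Q.natDegree ≠ 0 := by
  let index : Fin (2 * Q.natDegree) → ℕ ⊕ Fin Q.natDegree := fun r =>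
    if r.val % 2 = 0 then Sum.inl (Q.natDegree - 1 - r.val / 2)
    else Sum.inr ⟨Q.natDegree - 1 - r.val / 2, by omega⟩
  have hinj : Function.Injective index := by
    intro r r' h
    simp only [index] at h
    split_ifs at h <;> simp at h <;> omega
  have hind := (linearIndependent_shifts hQ.ne_zero hQ).comp index hinj
  have hrows : (fun r : Fin (2 * Q.natDegree) => X ^ (Q.natDegree - 1 - r.val / 2) *
      if r.val % 2 = 0 then Q else derivative Q) =
      Sum.elim (fun i => X ^ i * Q) (fun j => X ^ j.val * derivative Q) ∘ index := by
    ext1 r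
    simp only [Function.comp_apply, index]
    split_ifs <;> rfl
  rw [discrSeq, discrBlock_eq_coeffMatrix, hrows]
  refine det_coeffMatrix_ne_zero le_rfl (fun r => ?_) (fun r => one_dvd _) (by simp) hind
  have hr := r.isLt
  have hQ' := natDegree_derivative_le Q
  simp only [Function.comp_apply, index]
  split_ifs
  all_goals
    refine natDegree_mul_le.trans_lt ?_
    rw [natDegree_X_pow]
    omega

theorem map_discrSeq {S : Type*} [CommRing S] (φ : R →+* S) (Q : R[X])
    (h : (Q.map φ).natDegree = Q.natDegree) (j : ℕ) :
    φ (discrSeq Q j) = discrSeq (Q.map φ) j := by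
  rw [discrSeq, discrSeq, RingHom.map_det]
  congr 1
  ext r c
  simp only [discrBlock, RingHom.mapMatrix_apply, Matrix.map_apply, Matrix.of_apply, h,
    derivative_map, ← coeff_map, apply_ite φ, apply_ite (Polynomial.map φ), map_zero]

end DiscriminantSequence

section Homogeneity

variable {σ R : Type*} [CommRing R] {d : ℕ}

theorem isHomogeneous_det {m : Type*} [Fintype m] [DecidableEq m]
    {M : Matrix m m (MvPolynomial σ R)} (hM : ∀ r c, (M r c).IsHomogeneous d) :
    M.det.IsHomogeneous (Fintype.card m * d) := by
  rw [Matrix.det_apply']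
  refine MvPolynomial.IsHomogeneous.sum _ _ _ fun τ _ => ?_
  have hprod := MvPolynomial.IsHomogeneous.prod Finset.univ (fun c => M (τ c) c) (fun _ => d)
    fun c _ => hM (τ c) c
  rw [Finset.sum_const, Finset.card_univ, smul_eq_mul] at hprod
  simpa using hprod.C_mul (((Equiv.Perm.sign τ : ℤˣ) : ℤ) : R)

/-- All coefficients of the polynomial `Q` in `x` are homogeneous of degree `d` in the
parameters. -/
def HasHomogeneousCoeffs (Q : (MvPolynomial σ R)[X]) (d : ℕ) : Prop :=
  ∀ i, (Q.coeff i).IsHomogeneous d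

namespace HasHomogeneousCoeffs

variable {Q : (MvPolynomial σ R)[X]}

theorem X_pow_mul (hQ : HasHomogeneousCoeffs Q d) (k : ℕ) :
    HasHomogeneousCoeffs (X ^ k * Q) d := by
  intro i
  rw [coeff_X_pow_mul']
  split_ifs
  · exact hQ _
  · exact MvPolynomial.isHomogeneous_zero _ _ _

theorem derivative (hQ : HasHomogeneousCoeffs Q d) :
    HasHomogeneousCoeffs (derivative Q) d := by
  intro i
  rw [coeff_derivative, mul_comm]
  simpa using (hQ (i + 1)).C_mul ((i : R) + 1)

theorem iterate_derivative (hQ : HasHomogeneousCoeffs Q d) (k : ℕ) :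
    HasHomogeneousCoeffs (Polynomial.derivative^[k] Q) d := by
  induction k with
  | zero => exact hQ
  | succ k ih =>
    rw [Function.iterate_succ_apply']
    exact ih.derivative

theorem rowDetPoly {L : List (MvPolynomial σ R)[X]} (hL : ∀ f ∈ L, HasHomogeneousCoeffs f d)
    (q : ℕ) : HasHomogeneousCoeffs (rowDetPoly q L) (L.length * d) := by
  intro i
  rw [QXY.rowDetPoly]
  split_ifs with h
  · rw [coeff_detPoly]
    split_ifs
    · have hdet := isHomogeneous_det (d := d)
        (M := (coeffMatrix q L.get).submatrix id (detPolyColumn h i))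
        fun r _ => hL _ (L.get_mem r) _
      rwa [Fintype.card_fin] at hdet
    · exact MvPolynomial.isHomogeneous_zero _ _ _
  · exact MvPolynomial.isHomogeneous_zero _ _ _

theorem subres {F : ℕ → (MvPolynomial σ R)[X]} (hF : ∀ k, HasHomogeneousCoeffs (F k) d)
    (δ : List ℕ) : HasHomogeneousCoeffs (subres F δ) ((deltaZero F δ + δ.sum) * d) := by
  rw [subres_eq_rowDetPoly, ← length_sylvesterRows]
  refine rowDetPoly (fun f hf => ?_) _
  obtain ⟨i, k, -, rfl⟩ := exists_eq_X_pow_mul_of_mem_sylvesterRows hf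
  exact (hF i).X_pow_mul k

theorem discrSeq (hQ : HasHomogeneousCoeffs Q d) (j : ℕ) :
    (discrSeq Q j).IsHomogeneous (2 * j * d) := by
  have hdet := isHomogeneous_det (d := d) (M := discrBlock Q (2 * j)) fun r c => ?_
  · rwa [Fintype.card_fin] at hdet
  · rw [discrBlock, Matrix.of_apply]
    split_ifs
    · exact hQ _
    · exact hQ.derivative _
    · exact MvPolynomial.isHomogeneous_zero _ _ _

end HasHomogeneousCoeffs

end Homogeneity

section GenericPolynomial

theorem coeff_genericPoly (n i : ℕ) :
    (genericPoly n).coeff i = if h : i < n + 1 then MvPolynomial.X ⟨i, h⟩ else 0 := by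
  simp only [genericPoly, finsetSum_coeff, coeff_C_mul, coeff_X_pow]
  split_ifs with h
  · rw [Finset.sum_eq_single ⟨i, h⟩]
    · simp
    · intro j _ hj
      rw [if_neg fun e => hj (Fin.ext e.symm), mul_zero]
    · simp
  · refine Finset.sum_eq_zero fun j _ => ?_
    rw [if_neg (by omega), mul_zero]

theorem natDegree_genericPoly (n : ℕ) : (genericPoly n).natDegree = n := by
  refine natDegree_eq_of_le_of_coeff_ne_zero (natDegree_le_iff_coeff_eq_zero.2 fun i hi => ?_) ?_
  · rw [coeff_genericPoly, dif_neg (by omega)]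
  · rw [coeff_genericPoly, dif_pos (Nat.lt_succ_self n)]
    exact MvPolynomial.X_ne_zero _

theorem hasHomogeneousCoeffs_genericPoly (n : ℕ) : HasHomogeneousCoeffs (genericPoly n) 1 := by
  intro i
  rw [coeff_genericPoly]
  split_ifs
  · exact MvPolynomial.isHomogeneous_X _ _
  · exact MvPolynomial.isHomogeneous_zero _ _ _

theorem natDegree_iterate_derivative_eq {R : Type*} [Semiring R] [IsAddTorsionFree R] (f : R[X])
    (k : ℕ) : (derivative^[k] f).natDegree = f.natDegree - k := by
  induction k with
  | zero => rfl
  | succ k ih => rw [Function.iterate_succ_apply', natDegree_derivative, ih, Nat.sub_sub]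

theorem natDegree_derivs (n k : ℕ) : (derivs n k).natDegree = n - k := by
  rw [derivs, natDegree_iterate_derivative_eq, natDegree_genericPoly]

theorem deltaZero_derivs_cons {n a : ℕ} {l : List ℕ} (hn : 1 ≤ n) (ha : 1 ≤ a)
    (hl : ∀ b ∈ l, b ≤ a) : deltaZero (derivs n) (a :: l) = a - 1 := by
  have hle : ∀ k, (a :: l).getD k 0 ≤ a := by
    intro k
    rw [List.getD_eq_getElem?_getD]
    rcases h : (a :: l)[k]? with _ | b
    · exact Nat.zero_le a
    · exact (List.mem_cons.1 (List.mem_of_getElem? h)).elim le_of_eq (hl b)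
  have hmax : maxShift (derivs n) (a :: l) = n - 1 + a := by
    refine le_antisymm (Finset.sup_le fun k _ => ?_) ?_
    · rw [natDegree_derivs]
      have := hle k
      omega
    · have hfirst := le_maxShift (F := derivs n) (δ := a :: l) (k := 0)
        (by rw [List.getD_cons_zero]; omega)
      rwa [natDegree_derivs, List.getD_cons_zero] at hfirst
  rw [deltaZero, hmax, natDegree_derivs, if_pos (by omega)]
  omega

theorem hasHomogeneousCoeffs_subres_derivs_cons {n a : ℕ} {l : List ℕ} (hn : 1 ≤ n) (ha : 1 ≤ a)
    (hl : ∀ b ∈ l, b ≤ a) :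
    HasHomogeneousCoeffs (subres (derivs n) (a :: l)) (a - 1 + (a :: l).sum) := by
  have hsubres := HasHomogeneousCoeffs.subres
    (fun k => (hasHomogeneousCoeffs_genericPoly n).iterate_derivative k) (a :: l)
  change HasHomogeneousCoeffs (subres (derivs n) (a :: l))
    ((deltaZero (derivs n) (a :: l) + (a :: l).sum) * 1) at hsubres
  rwa [deltaZero_derivs_cons hn ha hl, mul_one] at hsubres

/-- The specialization of the parameters `a₀, …, a_n` to the coefficients of `f`. -/
noncomputable def specialize {K : Type*} [CommRing K] (n : ℕ) (f : K[X]) : Param n →+* K :=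
  MvPolynomial.eval₂Hom (Int.castRingHom K) fun i => f.coeff i

theorem map_specialize_derivs {K : Type*} [CommRing K] {n : ℕ} {f : K[X]} (hf : f.natDegree ≤ n)
    (k : ℕ) : (derivs n k).map (specialize n f) = derivative^[k] f := by
  have hgeneric : (genericPoly n).map (specialize n f) = f := by
    ext i
    rw [coeff_map, coeff_genericPoly]
    split_ifs with h
    · simp [specialize]
    · rw [map_zero, coeff_eq_zero_of_natDegree_lt (by omega)]
  rw [derivs, ← iterate_derivative_map, hgeneric]

theorem map_specialize_subres {K : Type*} [CommRing K] [IsAddTorsionFree K] (f : K[X])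
    (δ : List ℕ) :
    (subres (derivs f.natDegree) δ).map (specialize f.natDegree f) =
      subres (fun k => derivative^[k] f) δ := by
  rw [map_subres]
  · simp only [map_specialize_derivs le_rfl]
  · intro k
    rw [map_specialize_derivs le_rfl, natDegree_derivs, natDegree_iterate_derivative_eq]

end GenericPolynomial

section LowerBound

theorem isCoprime_of_separable_mul {R : Type*} [CommRing R] (h2 : IsUnit (2 : R)) {g h : R[X]}
    (hgh : (g * h).Separable) : IsCoprime (g * h) (2 * derivative g * h + g * derivative h) := by
  have h2' : IsUnit (2 : R[X]) := by simpa only [map_ofNat] using h2.map C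
  refine IsCoprime.mul_left ?_ ?_
  · rw [IsCoprime.add_mul_left_right_iff, mul_assoc, isCoprime_mul_unit_left_right h2']
    exact IsCoprime.mul_right hgh.of_mul_left hgh.isCoprime
  · rw [mul_comm _ h, add_comm, IsCoprime.add_mul_left_right_iff]
    exact hgh.isCoprime.symm.mul_right hgh.of_mul_right

/- Here `g` is the greatest common divisor of `f = g²h` and `f'`. -/
theorem associated_subres_iterate_derivative {K : Type*} [Field K] (h2 : (2 : K) ≠ 0) {g h : K[X]}
    (hgh : (g * h).Separable) (hdeg : 0 < (g * h).natDegree) :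
    Associated (subres (fun k => derivative^[k] (g * (g * h))) [(g * h).natDegree]) g := by
  refine associated_subres_singleton (left_ne_zero_of_mul hgh.ne_zero) hdeg
    (isCoprime_of_separable_mul h2.isUnit hgh) rfl ?_
  rw [Function.iterate_one, derivative_mul, derivative_mul]
  ring

theorem discrSeq_natDegree_ne_zero_of_map {R K : Type*} [CommRing R] [Field K] (φ : R →+* K)
    {Q : R[X]} (hdeg : (Q.map φ).natDegree = Q.natDegree) (hQ : (Q.map φ).Separable) :
    discrSeq Q Q.natDegree ≠ 0 := by
  intro h0
  have hne := discrSeq_natDegree_ne_zero hQ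
  rw [hdeg, ← map_discrSeq φ Q hdeg, h0, map_zero] at hne
  exact hne rfl

theorem discrSeq_subres_derivs_ne_zero {s t : ℕ} (ht : 1 ≤ t) (hst : s ≤ t) :
    discrSeq (subres (derivs (s + t)) [t]) s ≠ 0 := by
  let g : ℚ[X] := ∏ i ∈ Finset.range s, (X - C (i : ℚ))
  let h : ℚ[X] := ∏ i ∈ Finset.Ico s t, (X - C (i : ℚ))
  have hgh : g * h = ∏ i ∈ Finset.range t, (X - C (i : ℚ)) := Finset.prod_range_mul_prod_Ico _ hst
  have hsep : (g * h).Separable := by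
    rw [hgh, separable_prod_X_sub_C_iff']
    exact fun i _ j _ hij => Nat.cast_injective hij
  have hgdeg : g.natDegree = s := by
    rw [natDegree_finsetProd_X_sub_C_eq_card, Finset.card_range]
  have hghdeg : (g * h).natDegree = t := by
    rw [hgh, natDegree_finsetProd_X_sub_C_eq_card, Finset.card_range]
  have hfdeg : (g * (g * h)).natDegree = s + t := by
    rw [natDegree_mul (left_ne_zero_of_mul hsep.ne_zero) hsep.ne_zero, hgdeg, hghdeg]
  have hassoc := associated_subres_iterate_derivative two_ne_zero hsep (by omega)
  rw [← map_specialize_subres, hfdeg, hghdeg] at hassoc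
  have hmapdeg := natDegree_eq_of_degree_eq (degree_eq_degree_of_associated hassoc)
  rw [hgdeg] at hmapdeg
  have hdeg : (subres (derivs (s + t)) [t]).natDegree = s := by
    refine le_antisymm ?_ (hmapdeg.ge.trans natDegree_map_le)
    have hle := natDegree_subres_le (derivs (s + t)) [t]
    rwa [natDegree_derivs, List.sum_singleton, Nat.sub_zero, Nat.add_sub_cancel] at hle
  have hne := discrSeq_natDegree_ne_zero_of_map _ (hmapdeg.trans hdeg.symm)
    (hassoc.symm.separable hsep.of_mul_left)
  rwa [hdeg] at hne

end LowerBound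

section Conjugate

theorem conjPart_antitone (μ : List ℕ) : Antitone (conjPart μ) := fun _ _ hij =>
  List.countP_mono_left fun _ _ h => decide_eq_true (hij.trans (of_decide_eq_true h))

theorem conjPart_one {μ : List ℕ} (h : ∀ a ∈ μ, 1 ≤ a) : conjPart μ 1 = μ.length := by
  rw [conjPart, List.countP_eq_length]
  exact fun a ha => decide_eq_true (h a ha)

theorem take_conj {n i : ℕ} (hi : i ≤ n) (μ : List ℕ) : (conj n μ).take i = conj i μ := by
  rw [conj, ← List.map_take, List.take_range, min_eq_left hi, conj]

theorem conj_succ_eq_cons (i : ℕ) (μ : List ℕ) :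
    conj (i + 1) μ = conjPart μ 1 :: (List.range i).map fun k => conjPart μ (k + 2) := by
  rw [conj, List.range_succ_eq_map, List.map_cons, List.map_map]
  rfl

theorem sum_conj (n : ℕ) (μ : List ℕ) :
    (conj n μ).sum = ∑ i ∈ Finset.range n, conjPart μ (i + 1) := rfl

theorem sum_conj_succ (n : ℕ) (μ : List ℕ) :
    (conj (n + 1) μ).sum = (conj n μ).sum + conjPart μ (n + 1) := by
  rw [sum_conj, Finset.sum_range_succ, ← sum_conj]

theorem sum_conj_le (n : ℕ) (μ : List ℕ) : (conj n μ).sum ≤ μ.sum := by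
  induction μ with
  | nil => simp [sum_conj, conjPart]
  | cons a μ ih =>
    have hcons : ∀ i, conjPart (a :: μ) i = conjPart μ i + if i ≤ a then 1 else 0 := by
      simp [conjPart, List.countP_cons]
    have hcard : ∑ i ∈ Finset.range n, (if i + 1 ≤ a then 1 else 0) ≤ a := by
      rw [← Finset.card_filter]
      refine (Finset.card_le_card fun i hi => ?_).trans (Finset.card_range a).le
      exact Finset.mem_range.2 (Finset.mem_filter.1 hi).2
    rw [sum_conj] at ih
    simp only [sum_conj, hcons, Finset.sum_add_distrib, List.sum_cons]
    omega

theorem conjPart_one_le_sum_conj {i : ℕ} (hi : i ≠ 0) (μ : List ℕ) :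
    conjPart μ 1 ≤ (conj i μ).sum := by
  obtain ⟨i, rfl⟩ := Nat.exists_eq_succ_of_ne_zero hi
  rw [Nat.succ_eq_add_one, conj_succ_eq_cons, List.sum_cons]
  exact Nat.le_add_right _ _

namespace IsMult

variable {n : ℕ} {μ : List ℕ}

theorem ne_nil (h : IsMult n μ) (hn : n ≠ 0) : μ ≠ [] := by
  rintro rfl
  exact hn h.2.2.symm

theorem one_le_conjPart_one (h : IsMult n μ) (hn : n ≠ 0) : 1 ≤ conjPart μ 1 := by
  rw [conjPart_one h.2.1]
  exact List.length_pos_iff.2 (h.ne_nil hn)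

theorem conjPart_one_le (h : IsMult n μ) : conjPart μ 1 ≤ n := by
  rw [conjPart_one h.2.1]
  exact (List.length_le_sum_of_one_le μ h.2.1).trans_eq h.2.2

theorem headD_le (h : IsMult n μ) : μ.headD 0 ≤ n := by
  rw [← h.2.2]
  cases μ <;> simp

end IsMult

theorem incGcd_eq_subres {n i : ℕ} (hi : i ≠ 0) (hin : i ≤ n) (μ : List ℕ) :
    incGcd n μ i = subres (derivs n) (conj i μ) := by
  rw [incGcd, if_neg hi, take_conj hin]

theorem hasHomogeneousCoeffs_subres_derivs_conj {n i : ℕ} {μ : List ℕ} (hn : 1 ≤ n) (hi : i ≠ 0)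
    (hμ : 1 ≤ conjPart μ 1) :
    HasHomogeneousCoeffs (subres (derivs n) (conj i μ)) (conjPart μ 1 - 1 + (conj i μ).sum) := by
  obtain ⟨i, rfl⟩ := Nat.exists_eq_succ_of_ne_zero hi
  rw [Nat.succ_eq_add_one, conj_succ_eq_cons]
  refine hasHomogeneousCoeffs_subres_derivs_cons hn hμ ?_
  rw [List.forall_mem_map]
  exact fun k _ => conjPart_antitone μ (by omega)

end Conjugate

section UpperBound

theorem mul_le_mul_pred_of_add_lt {x y n : ℕ} (h : x + y < 2 * n) : x * y ≤ n * (n - 1) := by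
  obtain ⟨m, rfl⟩ := Nat.exists_eq_add_one.2 (show 0 < n by omega)
  wlog hxy : x ≤ y generalizing x y
  · rw [mul_comm]
    exact this (by omega) (by omega)
  obtain ⟨k, rfl⟩ := Nat.exists_eq_add_of_le (show x ≤ m by omega)
  calc x * y ≤ x * (x + 2 * k + 1) := Nat.mul_le_mul_left x (by omega)
    _ ≤ (x + k + 1) * (x + k + 1 - 1) := by
      rw [Nat.add_sub_cancel]
      nlinarith

theorem totalDegree_multDiscr_cons_le {n a : ℕ} {l : List ℕ} (ha : 1 ≤ a) (hl : ∀ b ∈ l, b ≤ a)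
    (hsum : (a :: l).sum ≤ n) : (multDiscr n (a :: l)).totalDegree ≤ 2 * n := by
  have han : a ≤ n := le_trans (by rw [List.sum_cons]; exact Nat.le_add_right _ _) hsum
  have hhom := hasHomogeneousCoeffs_subres_derivs_cons (ha.trans han) ha hl 0
  refine hhom.totalDegree_le.trans ?_
  omega

theorem IsMult.totalDegree_multDiscr_le {n : ℕ} {γ : List ℕ} (hγ : IsMult n γ) (hn : n ≠ 0) :
    (multDiscr n γ).totalDegree ≤ 2 * n := by
  obtain ⟨a, l, rfl⟩ := List.exists_cons_of_ne_nil (hγ.ne_nil hn)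
  exact totalDegree_multDiscr_cons_le (hγ.2.1 a List.mem_cons_self)
    (List.pairwise_cons.1 hγ.1).1 hγ.2.2.le

theorem IsMult.totalDegree_multDiscr_conj_le {n : ℕ} {μ : List ℕ} (hμ : IsMult n μ) (hn : n ≠ 0) :
    (multDiscr n (conj n μ)).totalDegree ≤ 2 * n := by
  have hone := hμ.one_le_conjPart_one hn
  have hhom := hasHomogeneousCoeffs_subres_derivs_conj (Nat.pos_of_ne_zero hn) hn hone 0
  have hle := hμ.conjPart_one_le
  have hsum := (sum_conj_le n μ).trans_eq hμ.2.2
  refine hhom.totalDegree_le.trans ?_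
  omega

theorem IsMult.totalDegree_discrSeq_genericPoly_le {n j : ℕ} {μ : List ℕ} (hμ : IsMult n μ)
    (hj : j ≤ conjPart μ 1) : (discrSeq (genericPoly n) j).totalDegree ≤ 2 * n := by
  refine ((hasHomogeneousCoeffs_genericPoly n).discrSeq j).totalDegree_le.trans ?_
  have := hμ.conjPart_one_le
  omega

theorem IsMult.totalDegree_discrSeq_incGcd_le {n i j : ℕ} {μ : List ℕ} (hμ : IsMult n μ)
    (hi : i ≠ 0) (hin : i < n) (hj : j ≤ conjPart μ (i + 1)) :
    (discrSeq (incGcd n μ i) j).totalDegree ≤ n * (n - 1) := by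
  have hone := hμ.one_le_conjPart_one (by omega)
  have hhom := (hasHomogeneousCoeffs_subres_derivs_conj (n := n) (by omega) hi hone).discrSeq j
  rw [incGcd_eq_subres hi hin.le]
  refine hhom.totalDegree_le.trans (mul_le_mul_pred_of_add_lt ?_)
  have hsum : (conj i μ).sum + conjPart μ (i + 1) ≤ n := by
    rw [← sum_conj_succ]
    exact (sum_conj_le _ μ).trans_eq hμ.2.2
  have hfirst := conjPart_one_le_sum_conj hi μ
  omega

theorem totalDegree_le_of_mem_conditionPolys {n : ℕ} (hn : 3 ≤ n) {p : Param n}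
    (hp : p ∈ conditionPolys n) : p.totalDegree ≤ n * (n - 1) := by
  have hn0 : n ≠ 0 := by omega
  have hlinear : 2 * n ≤ n * (n - 1) := by
    rw [mul_comm]
    exact Nat.mul_le_mul_left n (by omega)
  obtain ⟨_, ⟨μ, _, _, hμ, -, -, rfl⟩, _, (⟨γ, hγ, -, rfl⟩ | rfl) | ⟨i, hi, rfl⟩, hpA⟩ := hp
  · obtain rfl : p = multDiscr n γ := hpA
    exact (hγ.totalDegree_multDiscr_le hn0).trans hlinear
  · obtain rfl : p = multDiscr n (conj n μ) := hpA
    exact (hμ.totalDegree_multDiscr_conj_le hn0).trans hlinear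
  · obtain ⟨j, hj, rfl⟩ := List.mem_map.1 (show p ∈ List.map _ _ from hpA)
    have hj' : j + 1 ≤ conjPart μ (i + 1) := List.mem_range.1 hj
    rcases eq_or_ne i 0 with rfl | hi0
    · exact (hμ.totalDegree_discrSeq_genericPoly_le hj').trans hlinear
    · exact hμ.totalDegree_discrSeq_incGcd_le hi0 (hi.trans_le hμ.headD_le) hj'

end UpperBound

section Attainment

theorem IsMult.discrSeq_incGcd_mem_conditionPolys {n i j : ℕ} {μ : List ℕ} (hμ : IsMult n μ)
    (hi : i < μ.headD 0) (hj : j < conjPart μ (i + 1)) :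
    discrSeq (incGcd n μ i) (j + 1) ∈ conditionPolys n := by
  have hsplit : IsCompleteMult n μ [] :=
    ⟨hμ.1, hμ.2.1, by simp, by simp, by simp, by simp, by simpa using hμ.2.2⟩
  exact ⟨_, ⟨μ, μ, [], hμ, hsplit, by simp, rfl⟩, _, Or.inr ⟨i, hi, rfl⟩,
    List.mem_map.2 ⟨j, List.mem_range.2 hj, rfl⟩⟩

/-- The multiplicity vector `(2, …, 2, 1, …, 1)` with `t` entries, of which `s` are `2`; its
conjugate is `(t, s)`. -/
def twoOneMult (s t : ℕ) : List ℕ := List.replicate s 2 ++ List.replicate (t - s) 1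

theorem isMult_twoOneMult {s t : ℕ} (hst : s ≤ t) : IsMult (s + t) (twoOneMult s t) := by
  refine ⟨?_, ?_, ?_⟩
  · simp [twoOneMult, List.pairwise_append, List.pairwise_replicate, List.mem_replicate]
  · simp only [twoOneMult, List.mem_append, List.mem_replicate]
    omega
  · simp only [twoOneMult, List.sum_append, List.sum_replicate, smul_eq_mul]
    omega

theorem conjPart_one_twoOneMult {s t : ℕ} (hst : s ≤ t) : conjPart (twoOneMult s t) 1 = t := by
  rw [conjPart_one (isMult_twoOneMult hst).2.1, twoOneMult, List.length_append,
    List.length_replicate, List.length_replicate, Nat.add_sub_cancel' hst]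

theorem conjPart_two_twoOneMult (s t : ℕ) : conjPart (twoOneMult s t) 2 = s := by
  simp [twoOneMult, conjPart, List.countP_replicate]

theorem discrSeq_subres_derivs_mem_conditionPolys {s t : ℕ} (hs : 1 ≤ s) (hst : s ≤ t) :
    discrSeq (subres (derivs (s + t)) [t]) s ∈ conditionPolys (s + t) := by
  obtain ⟨s, rfl⟩ := Nat.exists_eq_add_one.2 hs
  have hmem := (isMult_twoOneMult hst).discrSeq_incGcd_mem_conditionPolys (i := 1) (j := s)
    (by simp [twoOneMult, List.replicate_succ])
    ((Nat.lt_succ_self s).trans_eq (conjPart_two_twoOneMult _ t).symm)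
  have hconj : conj 1 (twoOneMult (s + 1) t) = [t] :=
    (conj_succ_eq_cons 0 _).trans (by rw [conjPart_one_twoOneMult hst]; rfl)
  rwa [incGcd_eq_subres one_ne_zero (by omega), hconj] at hmem

theorem totalDegree_discrSeq_subres_derivs {s t : ℕ} (ht : 1 ≤ t) (hst : s ≤ t) :
    (discrSeq (subres (derivs (s + t)) [t]) s).totalDegree = 2 * s * (2 * t - 1) := by
  have hhom := (hasHomogeneousCoeffs_subres_derivs_cons (n := s + t) (l := []) (by omega) ht
    (by simp)).discrSeq s
  rw [hhom.totalDegree (discrSeq_subres_derivs_ne_zero ht hst), List.sum_singleton]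
  congr 1
  omega

theorem exists_mem_conditionPolys_totalDegree_eq {n : ℕ} (hn : 2 ≤ n) :
    ∃ p ∈ conditionPolys n, p.totalDegree = n * (n - 1) := by
  obtain ⟨s, t, hst, hts, rfl⟩ : ∃ s t, s ≤ t ∧ t ≤ s + 1 ∧ s + t = n :=
    ⟨n / 2, n - n / 2, by omega, by omega, by omega⟩
  refine ⟨_, discrSeq_subres_derivs_mem_conditionPolys (by omega) hst, ?_⟩
  rw [totalDegree_discrSeq_subres_derivs (by omega) hst]
  rcases hts.eq_or_lt with rfl | hlt
  · rw [mul_comm]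
    congr 1 <;> omega
  · obtain rfl : t = s := by omega
    rw [two_mul]

end Attainment

end QXY

theorem proposition4 (n : ℕ) (hn : 3 ≤ n) :
    IsGreatest {d : ℕ | ∃ p ∈ QXY.conditionPolys n, MvPolynomial.totalDegree p = d}
      (n * (n - 1)) := by
  refine ⟨QXY.exists_mem_conditionPolys_totalDegree_eq (by omega), ?_⟩
  rintro d ⟨p, hp, rfl⟩
  exact QXY.totalDegree_le_of_mem_conditionPolys hn hp
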